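/- Let $\Delta$ be the Cantor set and let $C(\Delta)$ be the Banach space of real-valued continuous functions on $\Delta$ with the supremum norm. Let $\mathrm{SB}$ be the set of all closed linear subspaces of $C(\Delta)$ (every separable real Banach space is isometric to one of them), with the Borel structure induced by the Effros-Borel structure on the set $\mathcal F(C(\Delta))$ of nonempty closed subsets of $C(\Delta)$, that is, by the $\sigma$-algebra generated by the sets $\{F\in\mathcal F(C(\Delta)) : F\cap U\neq\emptyset\}$ with $U\subset C(\Delta)$ open. For a basis $(f_1,\dots,f_n)$ of a finite-dimensional real normed space $F$, a real number $M$ is called an unconditional constant of the basis if $\|\sum_i a_if_i\|\le M\|\sum_i c_if_i\|$ for all real $a_i,c_i$ with $|a_i|\le|c_i|$ for all $i$. A Banach space $X$ has local unconditional structure if there is $\lambda>0$ such that for every finite-dimensional subspace $E\subset X$ there are a finite-dimensional normed space $F$, a basis of $F$ with an unconditional constant $M$, and bounded linear operators $u:E\to F$ and $w:F\to X$ with $w(u(x))=x$ for all $x\in E$ and $M\,\|u\|\,\|w\|\le\lambda$. Theorem. The set $\mathrm{LUST}=\{X\in\mathrm{SB} : X \text{ has local unconditional structure}\}$ is a Borel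 subset of $\mathrm{SB}$. -/

import Mathlib

open TopologicalSpace

/-- The nonempty closed subsets of a topological space `X`. -/
def NonemptyClosed (X : Type*) [TopologicalSpace X] : Type _ :=
  {F : Closeds X // (F : Set X).Nonempty}

/-- The Effros-Borel structure: the sigma-algebra generated by the sets
`{F | F ∩ U ≠ ∅}`, where `U` ranges over the open subsets of `X`. -/
instance effrosBorel (X : Type*) [TopologicalSpace X] : MeasurableSpace (NonemptyClosed X) :=
  MeasurableSpace.generateFrom
    {A | ∃ U : Set X, IsOpen U ∧ A = {F : NonemptyClosed X | ((F.1 : Set X) ∩ U).Nonempty}}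

instance instCompactSpaceCantorSet : CompactSpace cantorSet :=
  isCompact_iff_compactSpace.mp isCompact_cantorSet

/-- The Banach space of real continuous functions on the Cantor set, with the sup norm. -/
abbrev CCantor : Type := C(cantorSet, ℝ)

/-- The coding of separable real Banach spaces: all closed linear subspaces of
the space of continuous functions on the Cantor set. -/
abbrev SB : Type := ClosedSubmodule ℝ CCantor

/-- The inclusion of `SB` into the nonempty closed subsets. -/
def SB.toNonemptyClosed (X : SB) : NonemptyClosed CCantor :=
  ⟨X.toCloseds, ⟨0, X.toSubmodule.zero_mem⟩⟩

/-- `SB` carries the Borel structure induced by the Effros-Borel structure. -/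
instance SB.instMeasurableSpace : MeasurableSpace SB :=
  MeasurableSpace.comap SB.toNonemptyClosed (effrosBorel CCantor)

/-- `M` is an unconditional constant of the finite basis `b`. -/
def IsUnconditionalConstant {n : ℕ} {F : Type*} [NormedAddCommGroup F] [NormedSpace ℝ F]
    (b : Module.Basis (Fin n) ℝ F) (M : ℝ) : Prop :=
  ∀ a c : Fin n → ℝ, (∀ i, |a i| ≤ |c i|) →
    ‖∑ i, a i • b i‖ ≤ M * ‖∑ i, c i • b i‖

/-- Local unconditional structure of a real normed space `X`. The factoring spaces `F` are
all finite dimensional normed spaces with carrier in `Type`; up to isometry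
these are all finite dimensional normed spaces. -/
def HasLocalUnconditionalStructure (X : Type*) [NormedAddCommGroup X] [NormedSpace ℝ X] : Prop :=
  ∃ lam : ℝ, 0 < lam ∧ ∀ E : Submodule ℝ X, FiniteDimensional ℝ E →
    ∃ (F : Type) (_ : NormedAddCommGroup F) (_ : NormedSpace ℝ F)
      (n : ℕ) (b : Module.Basis (Fin n) ℝ F) (M : ℝ) (u : E →L[ℝ] F) (w : F →L[ℝ] X),
      IsUnconditionalConstant b M ∧ (∀ x : E, w (u x) = (x : X)) ∧ M * ‖u‖ * ‖w‖ ≤ lam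

/-- The set of all codes of separable Banach spaces with local unconditional structure. -/
def LUST : Set SB := {X | HasLocalUnconditionalStructure X.toSubmodule}

/-! The spaces `F` can be eliminated: a factorization through a basis amounts to vectors `y i` of
`X` and coordinates `U` for which the operators `x ↦ ∑ s i * U x i • y i`, `|s i| ≤ 1`, are
uniformly bounded (`hasLocalUnconditionalStructure_iff`). Conversely, such bounds yield an
unconditional norm on `ℝⁿ`.

This form is stable. With the coefficient matrix fixed, moving the vectors costs a controlled error
(`ApproxFactorization.perturb`). A small error is removed by inverting an operator close to the
identity, which only enlarges the constant (`HasUnconditionalFactorization.of_approxFactorization`).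
So all vectors may come from a dense sequence of `C(Δ)`, and `X` enters only through which balls of
radius `1/(k+1)` about its points it meets. These are Borel conditions, combined by countable
quantifiers. -/

open Finset

section Coefficients

variable {V : Type*} [NormedAddCommGroup V] [NormedSpace ℝ V]

/-! ### Eliminating the factoring space -/

/-- The identity of `E` factors through `Fin n → ℝ` in such a way that every diagonal multiplier
with entries in `[-1, 1]` induces an operator of norm at most `lam`. -/
def HasUnconditionalFactorization (lam : ℝ) (E : Submodule ℝ V) : Prop :=
  ∃ (n : ℕ) (y : Fin n → V) (U : E →L[ℝ] (Fin n → ℝ)),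
    (∀ x : E, ∑ i, U x i • y i = (x : V)) ∧
    ∀ s : Fin n → ℝ, (∀ i, |s i| ≤ 1) → ∀ x : E, ‖∑ i, (s i * U x i) • y i‖ ≤ lam * ‖x‖

/-- The coefficient matrix `u` represents the vectors `x j` through the vectors `y i` with
unconditional constant `lam`, up to an error `δ`. -/
def ApproxFactorization (lam δ : ℝ) {m n : ℕ} (x : Fin m → V) (y : Fin n → V)
    (u : Fin n → Fin m → ℝ) : Prop :=
  (∀ t : Fin m → ℝ,
    ‖∑ i, (∑ j, u i j * t j) • y i - ∑ j, t j • x j‖ ≤ δ * ∑ j, |t j|) ∧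
  ∀ s : Fin n → ℝ, (∀ i, |s i| ≤ 1) → ∀ t : Fin m → ℝ,
    ‖∑ i, (s i * ∑ j, u i j * t j) • y i‖ ≤ lam * ‖∑ j, t j • x j‖ + δ * ∑ j, |t j|

theorem HasUnconditionalFactorization.of_basis {lam : ℝ} {E : Submodule ℝ V} (hlam : 0 ≤ lam)
    {F : Type*} [NormedAddCommGroup F] [NormedSpace ℝ F] {n : ℕ} {b : Module.Basis (Fin n) ℝ F}
    {M : ℝ} {u : E →L[ℝ] F} {w : F →L[ℝ] V} (hb : IsUnconditionalConstant b M)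
    (huw : ∀ x : E, w (u x) = (x : V)) (hM : M * ‖u‖ * ‖w‖ ≤ lam) :
    HasUnconditionalFactorization lam E := by
  have : FiniteDimensional ℝ F := b.finiteDimensional_of_finite
  refine ⟨n, fun i => w (b i),
    (LinearMap.toContinuousLinearMap (b.equivFun : F →ₗ[ℝ] (Fin n → ℝ))).comp u,
    fun x => ?_, fun s hs x => ?_⟩
  · conv_rhs => rw [← huw x, ← b.sum_equivFun (u x), map_sum]
    simp
  · have h1 : ∑ i, (s i * b.equivFun (u x) i) • w (b i)
        = w (∑ i, (s i * b.equivFun (u x) i) • b i) := by simp [map_sum]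
    have h2 := hb (fun i => s i * b.equivFun (u x) i) (b.equivFun (u x)) fun i => by
      rw [abs_mul]
      exact mul_le_of_le_one_left (abs_nonneg _) (hs i)
    rw [b.sum_equivFun] at h2
    change ‖∑ i, (s i * b.equivFun (u x) i) • w (b i)‖ ≤ _
    rw [h1]
    have h3 : ‖w (∑ i, (s i * b.equivFun (u x) i) • b i)‖ ≤ ‖w‖ * (M * ‖u x‖) :=
      (w.le_opNorm _).trans (mul_le_mul_of_nonneg_left h2 (norm_nonneg _))
    -- The definition allows `M < 0`; the vector to be bounded then vanishes.
    rcases le_or_gt 0 M with hM0 | hM0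
    · calc _ ≤ ‖w‖ * (M * ‖u x‖) := h3
        _ ≤ ‖w‖ * (M * (‖u‖ * ‖x‖)) := by gcongr; exact u.le_opNorm x
        _ = M * ‖u‖ * ‖w‖ * ‖x‖ := by ring
        _ ≤ lam * ‖x‖ := by gcongr
    · have h4 : ‖w‖ * (M * ‖u x‖) ≤ 0 :=
        mul_nonpos_of_nonneg_of_nonpos (norm_nonneg _)
          (mul_nonpos_of_nonpos_of_nonneg hM0.le (norm_nonneg _))
      exact (h3.trans h4).trans (by positivity)

/-- The coefficient vector `c` as the function `s ↦ ∑ i, s i * c i • y i` on the cube, together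
with the vector `κ • c`. -/
noncomputable def cubeEmbedding {n : ℕ} (y : Fin n → V) (κ : ℝ) :
    (Fin n → ℝ) →ₗ[ℝ] C(Fin n → Set.Icc (-1 : ℝ) 1, V) × (Fin n → ℝ) where
  toFun c := (⟨fun s => ∑ i, ((s i : ℝ) * c i) • y i, by fun_prop⟩, κ • c)
  map_add' c d := by
    ext
    · simp [mul_add, add_smul, sum_add_distrib]
    · simp [mul_add]
  map_smul' r c := by
    ext
    · simp [smul_sum, smul_smul, mul_left_comm]
    · simp [mul_left_comm]

theorem norm_cubeEmbedding_le_iff {n : ℕ} (y : Fin n → V) {κ : ℝ} {c : Fin n → ℝ} {r : ℝ}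
    (hr : 0 ≤ r) : ‖cubeEmbedding y κ c‖ ≤ r ↔
      (∀ s : Fin n → ℝ, (∀ i, |s i| ≤ 1) → ‖∑ i, (s i * c i) • y i‖ ≤ r) ∧ ‖κ • c‖ ≤ r := by
  rw [Prod.norm_def, max_le_iff, ContinuousMap.norm_le _ hr]
  refine and_congr ⟨fun h s hs => h fun i => ⟨s i, abs_le.1 (hs i)⟩,
    fun h s => h (fun i => s i) fun i => abs_le.2 (s i).2⟩ Iff.rfl

theorem cubeEmbedding_injective {n : ℕ} (y : Fin n → V) {κ : ℝ} (hκ : 0 < κ) :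
    Function.Injective (cubeEmbedding y κ) := fun c d h => by
  have h2 : κ • c = κ • d := congrArg Prod.snd h
  exact smul_right_injective _ hκ.ne' h2

theorem norm_cubeEmbedding_mono {n : ℕ} (y : Fin n → V) {κ : ℝ} {a c : Fin n → ℝ}
    (h : ∀ i, |a i| ≤ |c i|) : ‖cubeEmbedding y κ a‖ ≤ ‖cubeEmbedding y κ c‖ := by
  obtain ⟨h1, h2⟩ := (norm_cubeEmbedding_le_iff y (norm_nonneg _)).1
    (le_refl ‖cubeEmbedding y κ c‖)
  refine (norm_cubeEmbedding_le_iff y (norm_nonneg _)).2 ⟨fun s hs => ?_, h2.trans' ?_⟩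
  · have key : ∀ i, s i * a i = (s i * (a i / c i)) * c i := fun i => by
      rcases eq_or_ne (c i) 0 with hc | hc
      · have := h i
        rw [hc, abs_zero, abs_nonpos_iff] at this
        simp [hc, this]
      · field_simp
    simp_rw [key]
    refine h1 _ fun i => ?_
    rw [abs_mul, abs_div]
    exact mul_le_one₀ (hs i) (by positivity) (div_le_one_of_le₀ (h i) (abs_nonneg _))
  · rw [norm_smul, norm_smul]
    gcongr
    exact (pi_norm_le_iff_of_nonneg (norm_nonneg _)).2 fun i => (h i).trans (norm_le_pi_norm c i)

/-- `F` is the range of `J` with the norm of `G`; monotonicity makes the image of the standard basis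
unconditional with constant 1. -/
theorem exists_basis_of_norm_mono {V G : Type} [NormedAddCommGroup V] [NormedSpace ℝ V]
    [NormedAddCommGroup G] [NormedSpace ℝ G] {E : Submodule ℝ V} {n : ℕ} {μ : ℝ} (hμ : 0 ≤ μ)
    {J : (Fin n → ℝ) →ₗ[ℝ] G} (hJ : Function.Injective J)
    (hmono : ∀ a c : Fin n → ℝ, (∀ i, |a i| ≤ |c i|) → ‖J a‖ ≤ ‖J c‖)
    {U : E →ₗ[ℝ] (Fin n → ℝ)} {w : G →ₗ[ℝ] V} (hU : ∀ x, ‖J (U x)‖ ≤ μ * ‖x‖)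
    (hw : ∀ g, ‖w g‖ ≤ 1 * ‖g‖) (hwU : ∀ x : E, w (J (U x)) = x) :
    ∃ (F : Type) (_ : NormedAddCommGroup F) (_ : NormedSpace ℝ F)
      (n : ℕ) (b : Module.Basis (Fin n) ℝ F) (M : ℝ) (u : E →L[ℝ] F) (w : F →L[ℝ] V),
      IsUnconditionalConstant b M ∧ (∀ x : E, w (u x) = (x : V)) ∧ M * ‖u‖ * ‖w‖ ≤ μ := by
  let e := LinearEquiv.ofInjective J hJ
  let b : Module.Basis (Fin n) ℝ (LinearMap.range J) := (Pi.basisFun ℝ (Fin n)).map e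
  have hb : ∀ c : Fin n → ℝ, ∑ i, c i • b i = e c := fun c => by
    have : c = ∑ i, c i • Pi.basisFun ℝ (Fin n) i := by
      simpa using ((Pi.basisFun ℝ (Fin n)).sum_equivFun c).symm
    conv_rhs => rw [this, map_sum]
    simp [b]
  let u' : E →L[ℝ] LinearMap.range J := (e.toLinearMap ∘ₗ U).mkContinuous μ hU
  let w' : LinearMap.range J →L[ℝ] V :=
    (w ∘ₗ (LinearMap.range J).subtype).mkContinuous 1 fun f => hw f
  have hu' : ‖u'‖ ≤ μ := u'.opNorm_le_bound hμ hU
  have hw' : ‖w'‖ ≤ 1 := w'.opNorm_le_bound zero_le_one fun f => hw f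
  refine ⟨LinearMap.range J, inferInstance, inferInstance, n, b, 1, u', w',
    fun a c hac => ?_, hwU, ?_⟩
  · rw [hb, hb, one_mul]
    exact hmono a c hac
  · rw [one_mul]
    exact (mul_le_mul hu' hw' w'.opNorm_nonneg hμ).trans_eq (mul_one _)

theorem HasUnconditionalFactorization.exists_basis {V : Type} [NormedAddCommGroup V]
    [NormedSpace ℝ V] {lam : ℝ} {E : Submodule ℝ V}
    (h : HasUnconditionalFactorization lam E) :
    ∃ (F : Type) (_ : NormedAddCommGroup F) (_ : NormedSpace ℝ F)
      (n : ℕ) (b : Module.Basis (Fin n) ℝ F) (M : ℝ) (u : E →L[ℝ] F) (w : F →L[ℝ] V),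
      IsUnconditionalConstant b M ∧ (∀ x : E, w (u x) = (x : V)) ∧
        M * ‖u‖ * ‖w‖ ≤ max lam 1 := by
  obtain ⟨n, y, U, hU, hs⟩ := h
  -- The summand `κ • c` makes the norm definite even if some `y i` vanish; this `κ` keeps its
  -- contribution at most `‖x‖`.
  set κ : ℝ := (1 + ‖U‖)⁻¹ with hκdef
  have hκ : 0 < κ := by positivity
  -- Evaluation at `s = 1` recovers `∑ c i • y i`.
  let w : C(Fin n → Set.Icc (-1 : ℝ) 1, V) × (Fin n → ℝ) →ₗ[ℝ] V :=
    { toFun := fun f => f.1 fun _ => ⟨1, by norm_num⟩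
      map_add' := fun _ _ => rfl
      map_smul' := fun _ _ => rfl }
  refine exists_basis_of_norm_mono (U := U) (w := w) (by positivity)
    (cubeEmbedding_injective y hκ) (fun _ _ => norm_cubeEmbedding_mono y) (fun x => ?_)
    (fun f => ?_) fun x => ?_
  · rw [norm_cubeEmbedding_le_iff y (by positivity)]
    refine ⟨fun s h => (hs s h x).trans (by gcongr; exact le_max_left _ _), ?_⟩
    rw [norm_smul, Real.norm_of_nonneg hκ.le]
    calc κ * ‖U x‖ ≤ κ * ((1 + ‖U‖) * ‖x‖) := by
          gcongr
          exact (U.le_opNorm x).trans (by gcongr; linarith)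
      _ = 1 * ‖x‖ := by rw [hκdef, inv_mul_cancel_left₀ (by positivity), one_mul]
      _ ≤ max lam 1 * ‖x‖ := by gcongr; exact le_max_right _ _
  · rw [one_mul]
    exact (ContinuousMap.norm_coe_le_norm f.1 _).trans (norm_fst_le f)
  · change ∑ i, ((1 : ℝ) * U x i) • y i = _
    simpa using hU x

theorem hasLocalUnconditionalStructure_iff {X : Type} [NormedAddCommGroup X] [NormedSpace ℝ X] :
    HasLocalUnconditionalStructure X ↔ ∃ lam : ℝ, 0 < lam ∧ ∀ E : Submodule ℝ X,
      FiniteDimensional ℝ E → HasUnconditionalFactorization lam E := by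
  constructor
  · rintro ⟨lam, hlam, h⟩
    refine ⟨lam, hlam, fun E hE => ?_⟩
    obtain ⟨F, _, _, n, b, M, u, w, hb, huw, hM⟩ := h E hE
    exact .of_basis hlam.le hb huw hM
  · rintro ⟨lam, -, h⟩
    exact ⟨max lam 1, by positivity, fun E hE => (h E hE).exists_basis⟩

/-! ### Approximate factorizations and their stability -/

/-- Coefficient matrices act boundedly for the `ℓ¹`-norms. -/
theorem norm_sum_coeff_smul_le {m n : ℕ} {u : Fin n → Fin m → ℝ} {z : Fin n → V} {η δ : ℝ}
    (hz : ∀ i, ‖z i‖ ≤ η) (hu : ∀ j, (∑ i, |u i j|) * η ≤ δ) {s : Fin n → ℝ}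
    (hs : ∀ i, |s i| ≤ 1) (t : Fin m → ℝ) :
    ‖∑ i, (s i * ∑ j, u i j * t j) • z i‖ ≤ δ * ∑ j, |t j| := by
  calc ‖∑ i, (s i * ∑ j, u i j * t j) • z i‖
      ≤ ∑ i, (∑ j, |u i j| * |t j|) * η := by
        refine norm_sum_le_of_le _ fun i _ => ?_
        rw [norm_smul, Real.norm_eq_abs, abs_mul]
        gcongr
        · calc |s i| * |∑ j, u i j * t j| ≤ 1 * ∑ j, |u i j * t j| := by
                gcongr
                · exact hs i
                · exact abs_sum_le_sum_abs _ _
            _ = _ := by simp [abs_mul]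
        · exact hz i
    _ = ∑ j, ((∑ i, |u i j|) * η) * |t j| := by
        simp_rw [sum_mul]
        rw [sum_comm]
        exact sum_congr rfl fun j _ => sum_congr rfl fun i _ => by ring
    _ ≤ δ * ∑ j, |t j| := by
        rw [mul_sum]
        gcongr with j
        exact hu j

theorem norm_sum_smul_le_mul_sum_abs {m : ℕ} {x : Fin m → V} {δ : ℝ} (hx : ∀ j, ‖x j‖ ≤ δ)
    (t : Fin m → ℝ) : ‖∑ j, t j • x j‖ ≤ δ * ∑ j, |t j| := by
  rw [mul_sum]
  refine norm_sum_le_of_le _ fun j _ => ?_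
  rw [norm_smul, Real.norm_eq_abs, mul_comm]
  gcongr
  exact hx j

theorem ApproxFactorization.perturb {lam δ δ' η : ℝ} {m n : ℕ} {x x' : Fin m → V}
    {y y' : Fin n → V} {u : Fin n → Fin m → ℝ} (h : ApproxFactorization lam δ x y u)
    (hlam : 0 ≤ lam) (hδ' : 0 ≤ δ')
    (hx : ∀ j, ‖x j - x' j‖ ≤ δ') (hy : ∀ i, ‖y' i - y i‖ ≤ η)
    (hu : ∀ j, (∑ i, |u i j|) * η ≤ δ') :
    ApproxFactorization lam (δ + (lam + 2) * δ') x' y' u := by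
  have hT : ∀ t : Fin m → ℝ, 0 ≤ ∑ j, |t j| := fun t => sum_nonneg fun _ _ => abs_nonneg _
  have hX := norm_sum_smul_le_mul_sum_abs hx
  refine ⟨fun t => ?_, fun s hs t => ?_⟩
  · have h1 := norm_sum_coeff_smul_le (s := fun _ => 1) hy hu (by simp) t
    have e : ∑ i, (∑ j, u i j * t j) • y' i - ∑ j, t j • x' j =
        (∑ i, (∑ j, u i j * t j) • y i - ∑ j, t j • x j) +
          (∑ i, ((1 : ℝ) * ∑ j, u i j * t j) • (y' i - y i) + ∑ j, t j • (x j - x' j)) := by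
      simp only [one_mul, smul_sub, sum_sub_distrib]
      abel
    rw [e]
    refine (norm_add_le_of_le (h.1 t) (norm_add_le_of_le h1 (hX t))).trans ?_
    have : 0 ≤ lam * (δ' * ∑ j, |t j|) := mul_nonneg hlam (mul_nonneg hδ' (hT t))
    linarith
  · have h1 := norm_sum_coeff_smul_le hy hu hs t
    have e : ∑ i, (s i * ∑ j, u i j * t j) • y' i =
        ∑ i, (s i * ∑ j, u i j * t j) • y i + ∑ i, (s i * ∑ j, u i j * t j) • (y' i - y i) := by
      simp only [smul_sub, sum_sub_distrib]
      abel
    have e2 : ∑ j, t j • x j = ∑ j, t j • x' j + ∑ j, t j • (x j - x' j) := by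
      simp only [smul_sub, sum_sub_distrib]
      abel
    have h2 : ‖∑ j, t j • x j‖ ≤ ‖∑ j, t j • x' j‖ + δ' * ∑ j, |t j| := by
      rw [e2]
      exact norm_add_le_of_le le_rfl (hX t)
    rw [e]
    refine (norm_add_le_of_le (h.2 s hs t) h1).trans ?_
    have h3 := mul_le_mul_of_nonneg_left h2 hlam
    have : 0 ≤ δ' * ∑ j, |t j| := mul_nonneg hδ' (hT t)
    linarith

theorem HasUnconditionalFactorization.exists_approxFactorization {lam : ℝ} {m : ℕ}
    {x : Fin m → V} (h : HasUnconditionalFactorization lam (Submodule.span ℝ (Set.range x))) :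
    ∃ (n : ℕ) (y : Fin n → V) (u : Fin n → Fin m → ℝ), ApproxFactorization lam 0 x y u := by
  obtain ⟨n, y, U, hU, hs⟩ := h
  let x' : Fin m → Submodule.span ℝ (Set.range x) :=
    fun j => ⟨x j, Submodule.subset_span ⟨j, rfl⟩⟩
  have hc : ∀ t : Fin m → ℝ, ((∑ j, t j • x' j : Submodule.span ℝ (Set.range x)) : V) =
      ∑ j, t j • x j := fun t => by simp [x']
  have hUx : ∀ (t : Fin m → ℝ) i, ∑ j, U (x' j) i * t j = U (∑ j, t j • x' j) i :=
    fun t i => by simp [map_sum, mul_comm]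
  refine ⟨n, y, fun i j => U (x' j) i, fun t => ?_, fun s h t => ?_⟩
  · simp_rw [hUx]
    rw [hU, hc]
    simp
  · simp_rw [hUx]
    refine (hs s h _).trans ?_
    rw [Submodule.coe_norm, hc]
    simp

/-- A continuous linear perturbation of the identity is invertible with inverse of norm at
most two. -/
theorem exists_leftInverse_one_add [CompleteSpace V] {S : V →L[ℝ] V} (hS : ‖S‖ ≤ 1 / 2) :
    ∃ W : V →L[ℝ] V, (∀ x, W (x + S x) = x) ∧ ∀ x, ‖W x‖ ≤ 2 * ‖x‖ := by
  obtain ⟨e, he⟩ := isUnit_one_sub_of_norm_lt_one (x := -S) (by rw [norm_neg]; linarith)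
  have hl : ∀ x, (↑e⁻¹ : V →L[ℝ] V) (x + S x) = x := fun x => by
    have := congrArg (fun f : V →L[ℝ] V => f x) e.inv_mul
    simpa [he] using this
  have hr : ∀ x, (↑e⁻¹ : V →L[ℝ] V) x + S ((↑e⁻¹ : V →L[ℝ] V) x) = x := fun x => by
    have := congrArg (fun f : V →L[ℝ] V => f x) e.mul_inv
    simpa [he] using this
  refine ⟨↑e⁻¹, hl, fun x => ?_⟩
  set z := (↑e⁻¹ : V →L[ℝ] V) x with hz
  have h1 : ‖S z‖ ≤ 1 / 2 * ‖z‖ := (S.le_opNorm z).trans (by gcongr)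
  have h2 : ‖z‖ ≤ ‖x‖ + ‖S z‖ := by
    have : z = x - S z := eq_sub_of_add_eq (hr x)
    calc ‖z‖ = ‖x - S z‖ := by rw [← this]
      _ ≤ _ := norm_sub_le _ _
  linarith

/-- On `E` the approximate factorization is a map `T` near the inclusion. Extended by a projection
onto `E`, the error has norm at most 1/2; an inverse `W` of identity plus error turns `y i` into
exact vectors `W (y i)`. -/
theorem HasUnconditionalFactorization.of_approxFactorization [CompleteSpace V] {lam : ℝ}
    (h : ∀ (m : ℕ) (x : Fin m → V) (δ : ℝ), 0 < δ →
      ∃ (n : ℕ) (y : Fin n → V) (u : Fin n → Fin m → ℝ), ApproxFactorization lam δ x y u)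
    (E : Submodule ℝ V) [FiniteDimensional ℝ E] :
    HasUnconditionalFactorization (2 * (lam + 1)) E := by
  let b := Module.finBasis ℝ E
  obtain ⟨P, hP⟩ := Submodule.ClosedComplemented.of_finiteDimensional E
  let B : E →L[ℝ] (Fin (Module.finrank ℝ E) → ℝ) :=
    LinearMap.toContinuousLinearMap (b.equivFun : E →ₗ[ℝ] _)
  set K : ℝ := Module.finrank ℝ E * ‖B‖ with hK
  have hsum : ∀ x : E, ∑ j, |b.equivFun x j| ≤ K * ‖x‖ := fun x => by
    calc ∑ j, |b.equivFun x j| ≤ ∑ _j : Fin (Module.finrank ℝ E), ‖B‖ * ‖x‖ :=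
          sum_le_sum fun j _ => (norm_le_pi_norm (B x) j).trans (B.le_opNorm x)
      _ = K * ‖x‖ := by simp [hK, mul_assoc]
  have hK0 : 0 ≤ K := by positivity
  -- Small enough for both `δ * K * ‖P‖ ≤ 1 / 2` and `δ * K ≤ 1`.
  set δ : ℝ := (2 * ((K + 1) * (‖P‖ + 1)))⁻¹ with hδ
  have hδ0 : 0 < δ := by positivity
  have hδK : δ * K * ‖P‖ ≤ 1 / 2 := by
    rw [hδ, mul_assoc, inv_mul_le_iff₀ (by positivity)]
    nlinarith [norm_nonneg P]
  have hδK1 : δ * K ≤ 1 := by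
    rw [hδ, inv_mul_le_iff₀ (by positivity)]
    nlinarith [norm_nonneg P, mul_nonneg hK0 (norm_nonneg P)]
  obtain ⟨n, y, u, hu1, hu2⟩ := h _ (fun j => (b j : V)) δ hδ0
  let U₀ : E →ₗ[ℝ] (Fin n → ℝ) := Matrix.mulVecLin (Matrix.of u) ∘ₗ b.equivFun
  let U : E →L[ℝ] (Fin n → ℝ) := LinearMap.toContinuousLinearMap U₀
  have hU : ∀ x i, ∑ j, u i j * b.equivFun x j = U x i := fun x i => rfl
  have hb : ∀ x : E, ∑ j, b.equivFun x j • (b j : V) = x := fun x => by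
    have := congrArg E.subtype (b.sum_equivFun x)
    rw [map_sum] at this
    exact this
  let T : E →L[ℝ] V := LinearMap.toContinuousLinearMap
    ((Fintype.linearCombination ℝ y) ∘ₗ (U : E →ₗ[ℝ] (Fin n → ℝ)))
  have hT : ∀ x, T x = ∑ i, U x i • y i := fun x => rfl
  have hT1 : ∀ x, ‖(T - E.subtypeL) x‖ ≤ δ * K * ‖x‖ := fun x => by
    have := hu1 (b.equivFun x)
    simp_rw [hU] at this
    rw [hb] at this
    rw [sub_apply, hT, mul_assoc]
    exact this.trans (by gcongr; exact hsum x)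
  have hS : ‖(T - E.subtypeL).comp P‖ ≤ 1 / 2 := by
    refine (ContinuousLinearMap.opNorm_comp_le _ _).trans (hδK.trans' ?_)
    gcongr
    exact ContinuousLinearMap.opNorm_le_bound _ (by positivity) hT1
  obtain ⟨W, hW, hWn⟩ := exists_leftInverse_one_add hS
  refine ⟨n, fun i => W (y i), U, fun x => ?_, fun s hs x => ?_⟩
  · have := hW x
    rw [ContinuousLinearMap.comp_apply, hP, sub_apply,
      Submodule.subtypeL_apply, add_sub_cancel, hT] at this
    simpa [map_sum] using this
  · have e : ∑ i, (s i * U x i) • W (y i) = W (∑ i, (s i * U x i) • y i) := by simp [map_sum]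
    rw [e, mul_assoc]
    refine (hWn _).trans ?_
    have := hu2 s hs (b.equivFun x)
    simp_rw [hU] at this
    rw [hb] at this
    have h2 : δ * ∑ j, |b.equivFun x j| ≤ 1 * ‖x‖ :=
      calc _ ≤ δ * (K * ‖x‖) := by gcongr; exact hsum x
        _ = δ * K * ‖x‖ := by ring
        _ ≤ _ := by gcongr
    have h3 : ‖(x : V)‖ = ‖x‖ := rfl
    rw [h3] at this
    linarith

theorem approxFactorization_coe_iff {X : Submodule ℝ V} {lam δ : ℝ} {m n : ℕ} {x : Fin m → X}
    {y : Fin n → X} {u : Fin n → Fin m → ℝ} :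
    ApproxFactorization lam δ (fun j => (x j : V)) (fun i => (y i : V)) u ↔
      ApproxFactorization lam δ x y u := by
  have h : ∀ (k : ℕ) (c : Fin k → ℝ) (z : Fin k → X),
      ∑ i, c i • (z i : V) = ((∑ i, c i • z i : X) : V) := fun k c z => by simp
  simp only [ApproxFactorization, h, ← Submodule.coe_sub, ← Submodule.coe_norm]

/-! ### Countable description and measurability -/

/-- A description of local unconditional structure in which the subspace only enters through
the balls around the points of a dense sequence that it meets. -/
theorem hasLocalUnconditionalStructure_iff_denseSeq {V : Type} [NormedAddCommGroup V]
    [NormedSpace ℝ V] (X : Submodule ℝ V) [CompleteSpace X] {d : ℕ → V} (hd : DenseRange d) :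
    HasLocalUnconditionalStructure X ↔ ∃ lam : ℕ, ∀ (m k : ℕ) (p : Fin m → ℕ),
      (∀ j, ((X : Set V) ∩ Metric.ball (d (p j)) (1 / (k + 1))).Nonempty) →
      ∃ (n : ℕ) (q : Fin n → ℕ) (l : ℕ),
        (∃ u : Fin n → Fin m → ℝ,
          ApproxFactorization lam ((lam + 2) * (1 / (k + 1))) (d ∘ p) (d ∘ q) u ∧
          ∀ j, (∑ i, |u i j|) * (1 / ((l : ℝ) + 1)) ≤ 1 / (k + 1)) ∧
        ∀ i, ((X : Set V) ∩ Metric.ball (d (q i)) (1 / (l + 1))).Nonempty := by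
  rw [hasLocalUnconditionalStructure_iff]
  constructor
  · rintro ⟨lam, hlam, h⟩
    obtain ⟨N, hN⟩ := exists_nat_ge lam
    refine ⟨N, fun m k p hp => ?_⟩
    choose x hxX hxp using hp
    let x' : Fin m → X := fun j => ⟨x j, hxX j⟩
    have : FiniteDimensional ℝ (Submodule.span ℝ (Set.range x')) :=
      FiniteDimensional.span_of_finite ℝ (Set.finite_range x')
    obtain ⟨n, y, u, hyu⟩ := (h _ this).exists_approxFactorization
    have hyu : ApproxFactorization N 0 x' y u :=
      ⟨hyu.1, fun s hs t => (hyu.2 s hs t).trans (by gcongr)⟩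
    have hk : (0 : ℝ) < 1 / (k + 1) := by positivity
    -- The radius for the `y i` is chosen after `u`, to offset its coefficients.
    obtain ⟨l, hl⟩ := exists_nat_ge ((∑ j, ∑ i, |u i j|) / (1 / ((k : ℝ) + 1)))
    have hl0 : (0 : ℝ) < 1 / (l + 1) := by positivity
    choose q hq using fun i => hd.exists_dist_lt (y i : V) hl0
    have hul : ∀ j, (∑ i, |u i j|) * (1 / ((l : ℝ) + 1)) ≤ 1 / (k + 1) := fun j => by
      rw [mul_one_div, div_le_iff₀ (by positivity)]
      have h1 : ∑ i, |u i j| ≤ ∑ j, ∑ i, |u i j| :=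
        single_le_sum (f := fun j => ∑ i, |u i j|)
          (fun j _ => sum_nonneg fun _ _ => abs_nonneg _) (mem_univ j)
      rw [div_le_iff₀ hk] at hl
      have : 1 / ((k : ℝ) + 1) * (l + 1) = l * (1 / (k + 1)) + 1 / (k + 1) := by ring
      linarith
    refine ⟨n, q, l, ⟨u, ?_, hul⟩, fun i => ⟨y i, (y i).2, by
      simpa [dist_comm] using hq i⟩⟩
    have := (approxFactorization_coe_iff.2 hyu).perturb (x' := d ∘ p) (y' := d ∘ q)
      (Nat.cast_nonneg N) hk.le
      (fun j => by simpa [dist_eq_norm] using (Metric.mem_ball.1 (hxp j)).le)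
      (fun i => by simpa [dist_eq_norm, norm_sub_rev] using (hq i).le) hul
    simpa using this
  · rintro ⟨N, h⟩
    refine ⟨2 * ((N : ℝ) + 1), by positivity, fun E hE =>
      .of_approxFactorization (fun m x δ hδ => ?_) E⟩
    -- The error `(N + 2) / (k + 1)` occurs twice: in `h` and in the perturbation back into `X`.
    obtain ⟨k, hk⟩ := exists_nat_one_div_lt (show (0 : ℝ) < δ / (2 * (N + 2)) by positivity)
    have hk0 : (0 : ℝ) < 1 / (k + 1) := by positivity
    choose p hp using fun j => hd.exists_dist_lt (x j : V) hk0
    obtain ⟨n, q, l, ⟨u, hu, hul⟩, hq⟩ := h m k p fun j => ⟨x j, (x j).2, hp j⟩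
    choose y hyX hyq using hq
    have hl0 : (0 : ℝ) < 1 / (l + 1) := by positivity
    refine ⟨n, fun i => ⟨y i, hyX i⟩, u, approxFactorization_coe_iff.1 ?_⟩
    have := hu.perturb (x' := fun j => (x j : V)) (y' := y) (Nat.cast_nonneg N) hk0.le
      (fun j => by simpa [dist_eq_norm, norm_sub_rev] using (hp j).le)
      (fun i => by simpa [dist_eq_norm] using (Metric.mem_ball.1 (hyq i)).le) hul
    rw [lt_div_iff₀ (by positivity)] at hk
    have hle : (N + 2) * (1 / ((k : ℝ) + 1)) + (N + 2) * (1 / (k + 1)) ≤ δ := by linarith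
    exact ⟨fun t => (this.1 t).trans (by gcongr), fun s hs t => (this.2 s hs t).trans (by gcongr)⟩

end Coefficients

theorem SB.measurableSet_inter_nonempty {U : Set CCantor} (hU : IsOpen U) :
    MeasurableSet {X : SB | ((X : Set CCantor) ∩ U).Nonempty} :=
  ⟨_, MeasurableSpace.measurableSet_generateFrom ⟨U, hU, rfl⟩, rfl⟩

theorem mainTheorem11 : MeasurableSet LUST := by
  have hd := TopologicalSpace.denseRange_denseSeq CCantor
  have key : LUST = {X : SB | ∃ lam : ℕ, ∀ (m k : ℕ) (p : Fin m → ℕ),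
      (∀ j, ((X : Set CCantor) ∩ Metric.ball (denseSeq CCantor (p j)) (1 / (k + 1))).Nonempty) →
      ∃ (n : ℕ) (q : Fin n → ℕ) (l : ℕ),
        (∃ u : Fin n → Fin m → ℝ,
          ApproxFactorization lam ((lam + 2) * (1 / (k + 1))) (denseSeq CCantor ∘ p)
            (denseSeq CCantor ∘ q) u ∧
          ∀ j, (∑ i, |u i j|) * (1 / ((l : ℝ) + 1)) ≤ 1 / (k + 1)) ∧
        ∀ i, ((X : Set CCantor) ∩
          Metric.ball (denseSeq CCantor (q i)) (1 / (l + 1))).Nonempty} := by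
    ext X
    have : CompleteSpace X.toSubmodule := X.isClosed.completeSpace_coe
    exact hasLocalUnconditionalStructure_iff_denseSeq X.toSubmodule hd
  rw [key]
  -- The only uncountable quantifier, over `u`, sits in a clause free of `X`, hence constant.
  refine measurableSet_setOfPred.2 <| .exists fun lam => .forall fun m => .forall fun k =>
    .forall fun p => .imp (.forall fun j => ?_) <| .exists fun n => .exists fun q =>
    .exists fun l => .and measurable_const (.forall fun i => ?_)
  all_goals exact measurableSet_setOfPred.1 (SB.measurableSet_inter_nonempty Metric.isOpen_ball)
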